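/- Let $n\ge 1$ be an integer, let $\mathbb{R}^n_+=\{(x',x_n): x'\in\mathbb{R}^{n-1},\ x_n>0\}$ be the upper half-space in $\mathbb{R}^n$ (with the Euclidean norm $|\cdot|$), and let $0<\alpha<1$. Let $U$ be a bounded real-valued harmonic function on $\mathbb{R}^n_+$ that is continuous on the closure $\overline{\mathbb{R}^n_+}$. Then the following three statements are equivalent: (H1) there is a constant $C_1$ such that $|U(x)-U(y)|\le C_1|x-y|^\alpha$ for all $x,y\in\mathbb{R}^n_+$; (H2) there is a constant $C_2$ such that $\bigl||U(x',0)|-|U(y',0)|\bigr|\le C_2|x'-y'|^\alpha$ for all $x',y'\in\mathbb{R}^{n-1}$; (H3) there is a constant $C_3$ such that $\bigl||U(x',x_n)|-|U(x',0)|\bigr|\le C_3\,x_n^\alpha$ for all $x'\in\mathbb{R}^{n-1}$ and all $x_n\in(0,\infty)$. -/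

import Mathlib

/-- The open upper half-space `{x ∈ ℝ^(d+1) : 0 < x_(d+1)}` of `ℝⁿ`, `n = d + 1`. -/
def upperHalfSpace (d : ℕ) : Set (EuclideanSpace ℝ (Fin (d + 1))) :=
  {x | 0 < x (Fin.last d)}

/-- The point `(x', t)` of `ℝ^(d+1)` with `x' ∈ ℝ^d` and last coordinate `t`. -/
def halfSpacePoint {d : ℕ} (x' : EuclideanSpace ℝ (Fin d)) (t : ℝ) :
    EuclideanSpace ℝ (Fin (d + 1)) :=
  WithLp.toLp 2 (Fin.snoc (α := fun _ => ℝ) (fun i => x' i) t)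

/-!
The proof uses only the weak maximum principle, in the strict form: a `C²` function with positive
Laplacian has no interior local maximum (`IsCompact.le_zero_of_laplacian_pos`). No Poisson kernel
is needed. Let `e` be the unit normal of the half-space and `n` its dimension.

*Removing the inner absolute values.* If `f` is continuous on `[a, b]` and `|f|` stays within `B` of
`|f a|`, then `|f b - f a| ≤ 3 B`: either `f a` and `f b` have the same sign, or `f` vanishes in
between and both values are small (`abs_sub_le_of_abs_abs_sub_abs_le`). Along segments in the
boundary, and along vertical segments, this turns the hypotheses on `|U|` into hypotheses on `U`.

*Boundary regularity gives regularity inside.* For `K` large the function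
`‖x - x₀‖ ^ α + K ⟪e, x⟫ ^ α` is strictly superharmonic and tends to infinity, so it dominates
bounded harmonic functions with `α`-Hölder boundary values
(`InnerProductSpace.HarmonicOnNhd.le_add_mul_halfSpaceBarrier`). Hence
`|U (x₀ + t e) - U x₀| ≤ C t ^ α` for boundary points `x₀`. For a shift `a` with `0 ≤ ⟪e, a⟫`, the
bounded harmonic function `x ↦ U (x + a) - U x` is then at most `C ‖a‖ ^ α` on the boundary, hence
everywhere (`IsBddHarmonicHalfSpace.holder_of_boundary`).

*Vertical regularity gives boundary regularity.* If `|U (x₀ + t e) - U x₀| ≤ C t ^ α` on the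
boundary, then `W_t x = U (x + t e) - U x` is bounded by `C t ^ α` everywhere. A harmonic
function bounded by `A` changes by at most `2 A (n + 1) ‖k‖ / t` under a tangential shift `k` at height
`t ≥ ‖k‖`. Applied to `W_t` with `t = 2 ^ j ‖k‖`, this bounds the change of `U (· + k) - U` between the
heights `t` and `2 t` by a constant times `‖k‖ ^ α 2 ^ ((α - 1) j)`, a convergent geometric
series as `α < 1`; and `U (· + k) - U` tends to `0` at infinite height because `U` is bounded
(`IsBddHarmonicHalfSpace.boundary_of_vertical`).
-/

open InnerProductSpace Filter Topology Laplacian Module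

/-! ### The Laplacian along lines, and the weak maximum principle -/

section

variable {E : Type*} [NormedAddCommGroup E] [InnerProductSpace ℝ E]

theorem ContDiffAt.iteratedDeriv_two_comp_add_smul {f : E → ℝ} {x : E} (hf : ContDiffAt ℝ 2 f x)
    (v : E) :
    iteratedDeriv 2 (fun s : ℝ ↦ f (x + s • v)) 0 = iteratedFDeriv ℝ 2 f x ![v, v] := by
  have hline : ∀ s : ℝ, HasDerivAt (fun s : ℝ ↦ x + s • v) v s := fun s ↦ by
    simpa using ((hasDerivAt_id s).smul_const v).const_add x
  have hev : ∀ᶠ s : ℝ in 𝓝 0, ContDiffAt ℝ 2 f (x + s • v) :=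
    (hline 0).continuousAt.eventually (by simpa using hf.eventually (by simp))
  have h1 : deriv (fun s : ℝ ↦ f (x + s • v)) =ᶠ[𝓝 0] fun s ↦ fderiv ℝ f (x + s • v) v := by
    filter_upwards [hev] with s hs
    exact ((hs.differentiableAt (by simp)).hasFDerivAt.comp_hasDerivAt s (hline s)).deriv
  have h2 : HasFDerivAt (fderiv ℝ f) (fderiv ℝ (fderiv ℝ f) x) (x + (0 : ℝ) • v) := by
    simpa using ((hf.fderiv_right (m := 1) (by norm_num)).differentiableAt (by simp)).hasFDerivAt
  have h3 : HasDerivAt (fun s : ℝ ↦ fderiv ℝ f (x + s • v)) (fderiv ℝ (fderiv ℝ f) x v) 0 :=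
    h2.comp_hasDerivAt (0 : ℝ) (hline 0)
  have h4 : HasDerivAt (fun s : ℝ ↦ fderiv ℝ f (x + s • v) v) (fderiv ℝ (fderiv ℝ f) x v v) 0 :=
    (ContinuousLinearMap.apply ℝ ℝ v).hasFDerivAt.comp_hasDerivAt (0 : ℝ) h3
  rw [iteratedDeriv_succ, iteratedDeriv_one, h1.deriv_eq, iteratedFDeriv_two_apply, h4.deriv]
  rfl

theorem IsLocalMax.iteratedDeriv_two_nonpos {g : ℝ → ℝ} {a : ℝ} (hmax : IsLocalMax g a)
    (hg : ContinuousAt g a) : iteratedDeriv 2 g a ≤ 0 := by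
  rw [iteratedDeriv_succ, iteratedDeriv_one]
  by_contra! hpos
  have hmin := isLocalMin_of_deriv_deriv_pos hpos hmax.deriv_eq_zero hg
  -- The point is both a local maximum and a local minimum, so `g` is constant near it.
  have hc : g =ᶠ[𝓝 a] fun _ ↦ g a := by
    filter_upwards [hmax, hmin] with s h1 h2 using le_antisymm h1 h2
  rw [hc.deriv.deriv_eq] at hpos
  simp at hpos

variable [FiniteDimensional ℝ E]

/-- The Laplacian is the sum of the second derivatives along the lines through the point in the
directions of an orthonormal basis. This reduces every Laplacian needed here to calculus on `ℝ`. -/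
theorem ContDiffAt.laplacian_eq_sum_iteratedDeriv {ι : Type*} [Fintype ι] {f : E → ℝ} {x : E}
    (hf : ContDiffAt ℝ 2 f x) (b : OrthonormalBasis ι ℝ E) :
    Δ f x = ∑ i, iteratedDeriv 2 (fun s : ℝ ↦ f (x + s • b i)) 0 := by
  rw [laplacian_eq_iteratedFDeriv_orthonormalBasis f b]
  exact Finset.sum_congr rfl fun i _ ↦ (hf.iteratedDeriv_two_comp_add_smul (b i)).symm

theorem IsLocalMax.laplacian_nonpos {f : E → ℝ} {x : E} (hmax : IsLocalMax f x)
    (hf : ContDiffAt ℝ 2 f x) : Δ f x ≤ 0 := by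
  rw [hf.laplacian_eq_sum_iteratedDeriv (stdOrthonormalBasis ℝ E)]
  refine Finset.sum_nonpos fun i _ ↦ ?_
  have hl : ContinuousAt (fun s : ℝ ↦ x + s • stdOrthonormalBasis ℝ E i) 0 := by fun_prop
  have hx : x + (0 : ℝ) • stdOrthonormalBasis ℝ E i = x := by simp
  refine IsLocalMax.iteratedDeriv_two_nonpos ?_ ?_
  · have := hl.tendsto
    simp only [hx] at this
    filter_upwards [this.eventually hmax] with s hs
    simpa using hs
  · exact ContinuousAt.comp (by simpa using hf.continuousAt) hl

/-- Weak maximum principle. A continuous function on a compact set `K`, strictly subharmonic in an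
open subset `Ω` of `K` and nonpositive on the rest of `K`, is nonpositive. -/
theorem IsCompact.le_zero_of_laplacian_pos {K Ω : Set E} (hK : IsCompact K) (hΩ : IsOpen Ω)
    (hΩK : Ω ⊆ K) {f : E → ℝ} (hcont : ContinuousOn f K) (hf : ∀ x ∈ Ω, ContDiffAt ℝ 2 f x)
    (hlap : ∀ x ∈ Ω, 0 < Δ f x) (hbdry : ∀ x ∈ K, x ∉ Ω → f x ≤ 0) {x : E} (hx : x ∈ K) :
    f x ≤ 0 := by
  obtain ⟨z, hzK, hz⟩ := hK.exists_isMaxOn ⟨x, hx⟩ hcont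
  refine (hz hx).trans (hbdry z hzK fun hzΩ ↦ (hlap z hzΩ).not_ge ?_)
  exact IsLocalMax.laplacian_nonpos
    (hz.isLocalMax (Filter.mem_of_superset (hΩ.mem_nhds hzΩ) hΩK)) (hf z hzΩ)

theorem LinearIsometryEquiv.laplacian_comp (L : E ≃ₗᵢ[ℝ] E) {f : E → ℝ} {x : E}
    (hf : ContDiffAt ℝ 2 f (L x)) : Δ (f ∘ L) x = Δ f (L x) := by
  have hfL : ContDiffAt ℝ 2 (f ∘ L) x := hf.comp x L.contDiff.contDiffAt
  rw [hfL.laplacian_eq_sum_iteratedDeriv (stdOrthonormalBasis ℝ E),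
    hf.laplacian_eq_sum_iteratedDeriv ((stdOrthonormalBasis ℝ E).map L)]
  simp

theorem InnerProductSpace.HarmonicAt.comp_linearIsometryEquiv {f : E → ℝ} {x : E}
    (L : E ≃ₗᵢ[ℝ] E) (hf : HarmonicAt f (L x)) : HarmonicAt (f ∘ L) x := by
  refine ⟨hf.1.comp x L.contDiff.contDiffAt, ?_⟩
  filter_upwards [L.continuous.continuousAt.eventually hf.2,
    L.continuous.continuousAt.eventually (hf.1.eventually (by simp))] with y hy hy'
  simpa [L.laplacian_comp hy'] using hy

theorem laplacian_comp_add_right (f : E → ℝ) (a x : E) :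
    Δ (fun y ↦ f (y + a)) x = Δ f (x + a) := by
  simp [laplacian_eq_iteratedFDeriv_stdOrthonormalBasis, iteratedFDeriv_comp_add_right]

theorem InnerProductSpace.HarmonicAt.comp_add_right {f : E → ℝ} {a x : E}
    (hf : HarmonicAt f (x + a)) : HarmonicAt (fun y ↦ f (y + a)) x := by
  have hc : ContinuousAt (fun y : E ↦ y + a) x := by fun_prop
  refine ⟨hf.1.comp x (contDiff_id.add contDiff_const).contDiffAt, ?_⟩
  filter_upwards [hc.eventually hf.2] with y hy
  simpa [laplacian_comp_add_right] using hy

end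

/-! ### An interior Lipschitz estimate for harmonic functions -/

section

variable {E : Type*} [NormedAddCommGroup E] [InnerProductSpace ℝ E]

theorem iteratedDeriv_two_quadratic (c₀ c₁ c₂ : ℝ) :
    iteratedDeriv 2 (fun s : ℝ ↦ c₀ + c₁ * s + c₂ * s ^ 2) 0 = 2 * c₂ := by
  have h1 : deriv (fun s : ℝ ↦ c₀ + c₁ * s + c₂ * s ^ 2) = fun s ↦ c₁ + 2 * c₂ * s := by
    funext s
    have := (((hasDerivAt_id s).const_mul c₁).const_add c₀).add
      (((hasDerivAt_id s).pow 2).const_mul c₂)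
    refine (this.congr_deriv ?_).deriv
    simp; ring
  rw [iteratedDeriv_succ, iteratedDeriv_one, h1]
  simp

theorem norm_add_smul_sq_real (x v : E) (hv : ‖v‖ = 1) (s : ℝ) :
    ‖x + s • v‖ ^ 2 = ‖x‖ ^ 2 + 2 * inner ℝ x v * s + s ^ 2 := by
  rw [norm_add_sq_real, inner_smul_right, norm_smul, hv]
  simp; ring

theorem contDiff_halfBall_barrier (e : E) (K r : ℝ) : ContDiff ℝ 2
    (fun y : E ↦ ‖y‖ ^ 2 + K * (r * inner ℝ e y - inner ℝ e y ^ 2)) := by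
  have hi : ContDiff ℝ 2 (fun y : E ↦ inner ℝ e y) := contDiff_const.inner ℝ contDiff_id
  exact (contDiff_norm_sq ℝ).add (contDiff_const.mul ((contDiff_const.mul hi).sub (hi.pow 2)))

variable [FiniteDimensional ℝ E]

/-- The Laplacian of the barrier on a half-ball. For `K > finrank ℝ E` it is negative; on the
half-ball `{‖y‖ ≤ r, 0 ≤ ⟪e, y⟫}` the barrier is nonnegative, at least `r ^ 2` on the spherical part
of the boundary, and `O(r ⟪e, y⟫)` along the axis `e`. -/
theorem laplacian_halfBall_barrier {e : E} (he : ‖e‖ = 1) (K r : ℝ) (x : E) :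
    Δ (fun y : E ↦ ‖y‖ ^ 2 + K * (r * inner ℝ e y - inner ℝ e y ^ 2)) x
      = 2 * finrank ℝ E - 2 * K := by
  have hC := contDiff_halfBall_barrier e K r
  set b := stdOrthonormalBasis ℝ E with hb
  rw [hC.contDiffAt.laplacian_eq_sum_iteratedDeriv b]
  have hsum : ∑ i, (inner ℝ e (b i)) ^ 2 = 1 := by
    have := b.sum_sq_norm_inner_left e
    simpa [he] using this
  have hi : ∀ i, iteratedDeriv 2 (fun s : ℝ ↦ ‖x + s • b i‖ ^ 2
      + K * (r * inner ℝ e (x + s • b i) - inner ℝ e (x + s • b i) ^ 2)) 0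
      = 2 - 2 * K * inner ℝ e (b i) ^ 2 := fun i ↦ by
    have : (fun s : ℝ ↦ ‖x + s • b i‖ ^ 2
      + K * (r * inner ℝ e (x + s • b i) - inner ℝ e (x + s • b i) ^ 2)) = fun s ↦
        (‖x‖ ^ 2 + K * (r * inner ℝ e x - inner ℝ e x ^ 2))
        + (2 * inner ℝ x (b i) + K * (r * inner ℝ e (b i) - 2 * inner ℝ e x * inner ℝ e (b i))) * s
        + (1 - K * inner ℝ e (b i) ^ 2) * s ^ 2 := by
      funext s
      rw [norm_add_smul_sq_real x (b i) (b.norm_eq_one i), inner_add_right, inner_smul_right]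
      ring
    rw [this, iteratedDeriv_two_quadratic]
    ring
  simp_rw [hi]
  rw [Finset.sum_sub_distrib, ← Finset.mul_sum, hsum]
  simp
  ring

/-- Lipschitz estimate for a harmonic function bounded on a ball, for points symmetric about the
center. The difference of `V` and its reflection in the hyperplane `eᗮ` is harmonic and vanishes on
that hyperplane, so a multiple of the half-ball barrier dominates it. -/
theorem InnerProductSpace.HarmonicOnNhd.sub_neg_le {V : E → ℝ} {r M : ℝ} (hr : 0 < r)
    (hM : 0 < M) (hV : HarmonicOnNhd V (Metric.closedBall 0 r))
    (hb : ∀ y ∈ Metric.closedBall (0 : E) r, |V y| ≤ M) {e : E} (he : ‖e‖ = 1) {a : ℝ}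
    (ha : 0 ≤ a) (har : a ≤ r) :
    V (a • e) - V (-(a • e)) ≤ 2 * M * (finrank ℝ E + 1) * (a / r) := by
  -- `K = n + 1` makes the barrier strictly superharmonic: its Laplacian is `2 n - 2 K = -2`.
  set K : ℝ := finrank ℝ E + 1 with hKdef
  have hK1 : 1 ≤ K := by simp [hKdef]
  set L : E ≃ₗᵢ[ℝ] E := (ℝ ∙ e)ᗮ.reflection with hL
  set ψ : E → ℝ := fun y ↦ ‖y‖ ^ 2 + K * (r * inner ℝ e y - inner ℝ e y ^ 2) with hψ
  have hψC : ContDiff ℝ 2 ψ := contDiff_halfBall_barrier e K r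
  have hLball : ∀ y ∈ Metric.closedBall (0 : E) r, L y ∈ Metric.closedBall (0 : E) r := by
    intro y hy; simpa using hy
  have hharm : ∀ y ∈ Metric.closedBall (0 : E) r, HarmonicAt (V - V ∘ L) y := fun y hy ↦
    (hV y hy).sub ((hV _ (hLball y hy)).comp_linearIsometryEquiv L)
  -- The barrier is at least `r ^ 2` on the sphere, where the difference is at most `2 M`.
  set c : ℝ := 2 * M / r ^ 2 with hc
  have hc0 : 0 < c := by positivity
  have hcC : ContDiff ℝ 2 (c • ψ) := contDiff_const.smul hψC
  have hclosed : IsClosed {y : E | 0 ≤ inner ℝ e y} :=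
    isClosed_le continuous_const (by fun_prop)
  have hopen : IsOpen {y : E | 0 < inner ℝ e y} := isOpen_lt continuous_const (by fun_prop)
  have hqle : ∀ y ∈ Metric.closedBall (0 : E) r, inner ℝ e y ≤ r := fun y hy ↦
    (real_inner_le_norm e y).trans (by simpa [he] using hy)
  have key := IsCompact.le_zero_of_laplacian_pos
    (K := Metric.closedBall 0 r ∩ {y : E | 0 ≤ inner ℝ e y})
    (Ω := Metric.ball 0 r ∩ {y : E | 0 < inner ℝ e y})
    (f := (V - V ∘ L) - c • ψ) (x := a • e)
    ((isCompact_closedBall 0 r).inter_right hclosed) (Metric.isOpen_ball.inter hopen)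
    (Set.inter_subset_inter Metric.ball_subset_closedBall
      (Set.ofPred_subset_ofPred.2 fun y hy ↦ le_of_lt hy))
    (fun y hy ↦ ((hharm y hy.1).1.sub hcC.contDiffAt).continuousAt.continuousWithinAt)
    (fun y hy ↦ (hharm y (Metric.ball_subset_closedBall hy.1)).1.sub hcC.contDiffAt)
    ?_ ?_ ?_
  · have hLa : L (a • e) = -(a • e) := by
      rw [map_smul, hL, Submodule.reflection_orthogonalComplement_singleton_eq_neg, smul_neg]
    have hψa : ψ (a • e) ≤ K * (r * a) := by
      have : inner ℝ e (a • e) = a := by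
        rw [inner_smul_right, real_inner_self_eq_norm_sq, he]; ring
      simp only [hψ, this, norm_smul, he, Real.norm_eq_abs, mul_one, sq_abs]
      nlinarith [sq_nonneg a]
    have : V (a • e) - V (-(a • e)) ≤ c * ψ (a • e) := by
      simpa [hLa, sub_nonpos] using key
    calc _ ≤ c * ψ (a • e) := this
      _ ≤ c * (K * (r * a)) := by gcongr
      _ = _ := by rw [hc]; field_simp
  · intro y hy
    have h0 := hharm y (Metric.ball_subset_closedBall hy.1)
    rw [h0.1.laplacian_sub hcC.contDiffAt, h0.2.self_of_nhds,
      laplacian_smul c hψC.contDiffAt, laplacian_halfBall_barrier he K r y]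
    simp only [Pi.zero_apply, smul_eq_mul, hKdef]
    nlinarith
  · rintro y ⟨hyb, hy0⟩ hyΩ
    have hy0' : 0 ≤ inner ℝ e y := hy0
    have hq := hqle y hyb
    have hquad : 0 ≤ K * (r * inner ℝ e y - inner ℝ e y ^ 2) :=
      mul_nonneg (by linarith) (by nlinarith)
    simp only [Pi.sub_apply, Function.comp_apply, Pi.smul_apply, smul_eq_mul, sub_nonpos]
    by_cases hyr : ‖y‖ < r
    · have hye : inner ℝ e y = 0 := by
        by_contra hne
        exact hyΩ ⟨by simpa using hyr, lt_of_le_of_ne hy0' (Ne.symm hne)⟩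
      have hLy : L y = y := by
        rw [hL, Submodule.reflection_eq_self_iff,
          Submodule.mem_orthogonal_singleton_iff_inner_right]
        exact hye
      rw [hLy, sub_self]
      have : 0 ≤ ψ y := by simp only [hψ]; positivity
      positivity
    · have hyr' : ‖y‖ = r := le_antisymm (by simpa using hyb) (not_lt.mp hyr)
      have hψr : r ^ 2 ≤ ψ y := by simp only [hψ, hyr']; linarith
      have h1 := abs_le.mp (hb y hyb)
      have h2 := abs_le.mp (hb _ (hLball y hyb))
      calc V y - V (L y) ≤ 2 * M := by linarith
        _ = c * r ^ 2 := by rw [hc]; field_simp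
        _ ≤ c * ψ y := by gcongr
  · refine ⟨by simpa [norm_smul, he, abs_of_nonneg ha] using har, ?_⟩
    simp only [Set.mem_ofPred_eq, inner_smul_right, real_inner_self_eq_norm_sq, he]
    simpa using ha

/-- The symmetric Lipschitz estimate about an arbitrary center: apply the one-sided estimate to the
unit vector `e` from `y` towards `x` and to `-e`. -/
theorem InnerProductSpace.HarmonicOnNhd.abs_sub_le_of_bounded_closedBall {V : E → ℝ} {r M : ℝ}
    (hr : 0 < r) (hM : 0 < M) {x y : E}
    (hV : HarmonicOnNhd V (Metric.closedBall (midpoint ℝ x y) r))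
    (hb : ∀ z ∈ Metric.closedBall (midpoint ℝ x y) r, |V z| ≤ M) (hxy : ‖x - y‖ ≤ 2 * r) :
    |V x - V y| ≤ M * (finrank ℝ E + 1) * (‖x - y‖ / r) := by
  rcases eq_or_ne x y with rfl | hne
  · simp
  have hn : 0 < ‖x - y‖ := norm_sub_pos_iff.mpr hne
  set p := midpoint ℝ x y with hp
  set e : E := ‖x - y‖⁻¹ • (x - y) with he_def
  have he : ‖e‖ = 1 := by rw [he_def, norm_smul, norm_inv, norm_norm, inv_mul_cancel₀ hn.ne']
  have hae : (‖x - y‖ / 2) • e = (1 / 2 : ℝ) • (x - y) := by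
    rw [he_def, smul_smul]; congr 1; field_simp
  have hx : (‖x - y‖ / 2) • e + p = x := by
    rw [hae, hp, midpoint_eq_smul_add, invOf_eq_inv]; module
  have hy : -((‖x - y‖ / 2) • e) + p = y := by
    rw [hae, hp, midpoint_eq_smul_add, invOf_eq_inv]; module
  have hball : ∀ z ∈ Metric.closedBall (0 : E) r, z + p ∈ Metric.closedBall p r := by
    intro z hz; simpa using hz
  have hV0 : HarmonicOnNhd (fun z ↦ V (z + p)) (Metric.closedBall 0 r) := fun z hz ↦
    (hV _ (hball z hz)).comp_add_right
  have h1 := hV0.sub_neg_le hr hM (fun z hz ↦ hb _ (hball z hz)) he (a := ‖x - y‖ / 2)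
    (by positivity) (by linarith)
  have h2 := hV0.sub_neg_le hr hM (fun z hz ↦ hb _ (hball z hz)) (e := -e) (by simpa using he)
    (a := ‖x - y‖ / 2) (by positivity) (by linarith)
  simp only [smul_neg, neg_neg, hx, hy] at h1 h2
  have h3 : 2 * M * (finrank ℝ E + 1) * (‖x - y‖ / 2 / r)
      = M * (finrank ℝ E + 1) * (‖x - y‖ / r) := by ring
  rw [h3] at h1 h2
  exact abs_le.mpr ⟨by linarith, h1⟩

end

/-! ### A superharmonic barrier on the half-space -/

section

variable {E : Type*} [NormedAddCommGroup E] [InnerProductSpace ℝ E]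

theorem iteratedDeriv_two_quadratic_rpow {a : ℝ} (ha : 0 < a) (b c β : ℝ) :
    iteratedDeriv 2 (fun s : ℝ ↦ (a + b * s + c * s ^ 2) ^ β) 0
      = β * (β - 1) * a ^ (β - 2) * b ^ 2 + 2 * c * β * a ^ (β - 1) := by
  have hq : ∀ s : ℝ, HasDerivAt (fun s : ℝ ↦ a + b * s + c * s ^ 2) (b + 2 * c * s) s := fun s ↦ by
    refine ((((hasDerivAt_id s).const_mul b).const_add a).add
      (((hasDerivAt_id s).pow 2).const_mul c)).congr_deriv ?_
    simp; ring
  have hpos : ∀ᶠ s : ℝ in 𝓝 0, 0 < a + b * s + c * s ^ 2 :=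
    (hq 0).continuousAt.eventually (lt_mem_nhds (by simpa using ha))
  have h1 : deriv (fun s : ℝ ↦ (a + b * s + c * s ^ 2) ^ β) =ᶠ[𝓝 0]
      fun s ↦ (b + 2 * c * s) * β * (a + b * s + c * s ^ 2) ^ (β - 1) := by
    filter_upwards [hpos] with s hs
    exact ((hq s).rpow_const (Or.inl hs.ne')).deriv
  have h2 : HasDerivAt (fun s : ℝ ↦ b + 2 * c * s) (2 * c) 0 := by
    simpa using ((hasDerivAt_id (0 : ℝ)).const_mul (2 * c)).const_add b
  have h3 := (h2.mul_const β).mul ((hq 0).rpow_const (p := β - 1) (Or.inl (by simpa using ha.ne')))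
  rw [iteratedDeriv_succ, iteratedDeriv_one, h1.deriv_eq]
  refine h3.deriv.trans ?_
  rw [show β - 1 - 1 = β - 2 by ring]
  simp
  ring

theorem contDiffAt_norm_sub_rpow {x x₀ : E} (hx : x ≠ x₀) (α : ℝ) :
    ContDiffAt ℝ 2 (fun y : E ↦ ‖y - x₀‖ ^ α) x :=
  ((contDiffAt_id.sub contDiffAt_const).norm ℝ (sub_ne_zero.2 hx)).rpow_const_of_ne
    (norm_ne_zero_iff.2 (sub_ne_zero.2 hx))

theorem contDiffAt_inner_rpow {e x : E} (hx : 0 < inner ℝ e x) (α : ℝ) :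
    ContDiffAt ℝ 2 (fun y : E ↦ inner ℝ e y ^ α) x :=
  (contDiffAt_const.inner ℝ contDiffAt_id).rpow_const_of_ne hx.ne'

/-- The barrier `‖x - x₀‖ ^ α + K ⟪e, x⟫ ^ α` on the half-space `{0 < ⟪e, x⟫}` with vertex `x₀` on
its boundary. The constant `K = (n + 1) / (1 - α)`, `n = finrank ℝ E`, is large enough for strict
superharmonicity when `0 < α < 1`. -/
noncomputable def halfSpaceBarrier (e x₀ : E) (α : ℝ) (x : E) : ℝ :=
  ‖x - x₀‖ ^ α + (finrank ℝ E + 1) / (1 - α) * inner ℝ e x ^ α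

theorem halfSpaceBarrier_nonneg {e x₀ x : E} {α : ℝ} (hα1 : α < 1) (hx : 0 ≤ inner ℝ e x) :
    0 ≤ halfSpaceBarrier e x₀ α x := by
  have : 0 < 1 - α := by linarith
  unfold halfSpaceBarrier
  positivity

theorem norm_sub_rpow_le_halfSpaceBarrier {e x₀ x : E} {α : ℝ} (hα1 : α < 1)
    (hx : 0 ≤ inner ℝ e x) : ‖x - x₀‖ ^ α ≤ halfSpaceBarrier e x₀ α x := by
  have : 0 < 1 - α := by linarith
  unfold halfSpaceBarrier
  exact le_add_of_nonneg_right (by positivity)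

theorem continuous_halfSpaceBarrier (e x₀ : E) {α : ℝ} (hα0 : 0 ≤ α) :
    Continuous (halfSpaceBarrier e x₀ α) := by
  unfold halfSpaceBarrier
  exact ((continuous_id.sub continuous_const).norm.rpow_const fun _ ↦ Or.inr hα0).add
    (continuous_const.mul ((continuous_const.inner continuous_id).rpow_const fun _ ↦ Or.inr hα0))

theorem ne_of_inner_pos {e x₀ x : E} (hx₀ : inner ℝ e x₀ = 0) (hx : 0 < inner ℝ e x) : x ≠ x₀ := by
  rintro rfl; exact hx.ne' hx₀

theorem contDiffAt_halfSpaceBarrier {e x₀ x : E} (hx₀ : inner ℝ e x₀ = 0)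
    (hx : 0 < inner ℝ e x) (α : ℝ) : ContDiffAt ℝ 2 (halfSpaceBarrier e x₀ α) x :=
  (contDiffAt_norm_sub_rpow (ne_of_inner_pos hx₀ hx) α).add
    (contDiffAt_const.mul (contDiffAt_inner_rpow hx α))

variable [FiniteDimensional ℝ E]

theorem laplacian_norm_sub_rpow_le {x x₀ : E} (hx : x ≠ x₀) {α : ℝ} (hα0 : 0 ≤ α) (hα2 : α ≤ 2) :
    Δ (fun y : E ↦ ‖y - x₀‖ ^ α) x ≤ α * finrank ℝ E * ‖x - x₀‖ ^ (α - 2) := by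
  have hn : 0 < ‖x - x₀‖ := norm_sub_pos_iff.mpr hx
  set b := stdOrthonormalBasis ℝ E
  rw [(contDiffAt_norm_sub_rpow hx α).laplacian_eq_sum_iteratedDeriv b]
  have hi : ∀ i, iteratedDeriv 2 (fun s : ℝ ↦ ‖x + s • b i - x₀‖ ^ α) 0
      ≤ α * ‖x - x₀‖ ^ (α - 2) := fun i ↦ by
    have : (fun s : ℝ ↦ ‖x + s • b i - x₀‖ ^ α) = fun s ↦
        (‖x - x₀‖ ^ 2 + 2 * inner ℝ (x - x₀) (b i) * s + 1 * s ^ 2) ^ (α / 2) := by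
      funext s
      rw [one_mul, ← norm_add_smul_sq_real _ _ (b.norm_eq_one i), ← Real.rpow_natCast,
        ← Real.rpow_mul (norm_nonneg _), add_sub_right_comm]
      congr 1; push_cast; ring
    rw [this, iteratedDeriv_two_quadratic_rpow (by positivity)]
    have h1 : (‖x - x₀‖ ^ 2) ^ (α / 2 - 1) = ‖x - x₀‖ ^ (α - 2) := by
      rw [← Real.rpow_natCast, ← Real.rpow_mul hn.le]; congr 1; push_cast; ring
    have h2 : 0 ≤ α / 2 * (1 - α / 2) * (‖x - x₀‖ ^ 2) ^ (α / 2 - 2)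
        * (2 * inner ℝ (x - x₀) (b i)) ^ 2 := by
      have : 0 ≤ 1 - α / 2 := by linarith
      positivity
    rw [h1]
    nlinarith
  calc _ ≤ ∑ _i, α * ‖x - x₀‖ ^ (α - 2) := Finset.sum_le_sum fun i _ ↦ hi i
    _ = _ := by simp; ring

theorem laplacian_inner_rpow {e x : E} (he : ‖e‖ = 1) (hx : 0 < inner ℝ e x) (α : ℝ) :
    Δ (fun y : E ↦ inner ℝ e y ^ α) x = α * (α - 1) * inner ℝ e x ^ (α - 2) := by
  set b := stdOrthonormalBasis ℝ E
  rw [(contDiffAt_inner_rpow hx α).laplacian_eq_sum_iteratedDeriv b]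
  have hi : ∀ i, iteratedDeriv 2 (fun s : ℝ ↦ inner ℝ e (x + s • b i) ^ α) 0
      = α * (α - 1) * inner ℝ e x ^ (α - 2) * inner ℝ e (b i) ^ 2 := fun i ↦ by
    have : (fun s : ℝ ↦ inner ℝ e (x + s • b i) ^ α) = fun s ↦
        (inner ℝ e x + inner ℝ e (b i) * s + 0 * s ^ 2) ^ α := by
      funext s
      rw [inner_add_right, inner_smul_right]
      congr 1; ring
    rw [this, iteratedDeriv_two_quadratic_rpow hx]
    ring
  have hsum : ∑ i, (inner ℝ e (b i)) ^ 2 = 1 := by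
    have := b.sum_sq_norm_inner_left e
    simpa [he] using this
  simp_rw [hi]
  rw [← Finset.mul_sum, hsum, mul_one]

/-- The barrier is strictly superharmonic: as `⟪e, x⟫ ≤ ‖x - x₀‖` and `α - 2 < 0`, the negative
Laplacian of `K ⟪e, x⟫ ^ α` outweighs that of `‖x - x₀‖ ^ α`. -/
theorem laplacian_halfSpaceBarrier_neg {e x₀ x : E} (he : ‖e‖ = 1) (hx₀ : inner ℝ e x₀ = 0)
    (hx : 0 < inner ℝ e x) {α : ℝ} (hα0 : 0 < α) (hα1 : α < 1) :
    Δ (halfSpaceBarrier e x₀ α) x < 0 := by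
  have hne := ne_of_inner_pos hx₀ hx
  have hcd := contDiffAt_inner_rpow hx α
  have h1 : 0 < 1 - α := by linarith
  set k : ℝ := (finrank ℝ E + 1) / (1 - α) with hk
  have hks : ContDiffAt ℝ 2 (k • fun y : E ↦ inner ℝ e y ^ α) x := hcd.const_smul k
  have heq : halfSpaceBarrier e x₀ α
      = (fun y : E ↦ ‖y - x₀‖ ^ α) + k • (fun y : E ↦ inner ℝ e y ^ α) := rfl
  have hle : inner ℝ e x ≤ ‖x - x₀‖ := by
    have := real_inner_le_norm e (x - x₀)
    rwa [inner_sub_right, hx₀, sub_zero, he, one_mul] at this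
  have hpow : ‖x - x₀‖ ^ (α - 2) ≤ inner ℝ e x ^ (α - 2) :=
    Real.rpow_le_rpow_of_nonpos hx hle (by linarith)
  have htpos : 0 < inner ℝ e x ^ (α - 2) := Real.rpow_pos_of_pos hx _
  rw [heq, (contDiffAt_norm_sub_rpow hne α).laplacian_add hks,
    laplacian_smul k hcd, laplacian_inner_rpow he hx]
  have hk' : k * (1 - α) = finrank ℝ E + 1 := by rw [hk]; field_simp
  calc _ ≤ α * finrank ℝ E * inner ℝ e x ^ (α - 2)
        + k • (α * (α - 1) * inner ℝ e x ^ (α - 2)) := by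
        refine add_le_add_left ((laplacian_norm_sub_rpow_le hne hα0.le (by linarith)).trans ?_) _
        gcongr
    _ = α * inner ℝ e x ^ (α - 2) * (finrank ℝ E - k * (1 - α)) := by
        rw [smul_eq_mul]; ring
    _ < 0 := by rw [hk']; nlinarith [mul_pos hα0 htpos]

/-- Maximum principle on the half-space with Hölder boundary data: a harmonic function bounded
above, with boundary values at most `m + c ‖x - x₀‖ ^ α`, is at most `m + c w` inside, where `w`
is the barrier with vertex `x₀`. For `c = 0` this is the maximum principle of Phragmén–Lindelöf
type. -/
theorem InnerProductSpace.HarmonicOnNhd.le_add_mul_halfSpaceBarrier {e x₀ : E} (he : ‖e‖ = 1)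
    (hx₀ : inner ℝ e x₀ = 0) {α : ℝ} (hα0 : 0 < α) (hα1 : α < 1) {V : E → ℝ} {M m c : ℝ}
    (hc : 0 ≤ c) (hV : HarmonicOnNhd V {x | 0 < inner ℝ e x})
    (hcont : ContinuousOn V {x | 0 ≤ inner ℝ e x}) (hM : ∀ x, 0 < inner ℝ e x → V x ≤ M)
    (hbdry : ∀ x, inner ℝ e x = 0 → V x ≤ m + c * ‖x - x₀‖ ^ α) {x : E} (hx : 0 ≤ inner ℝ e x) :
    V x ≤ m + c * halfSpaceBarrier e x₀ α x := by
  have hw : ∀ y, 0 ≤ inner ℝ e y → 0 ≤ halfSpaceBarrier e x₀ α y := fun y hy ↦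
    halfSpaceBarrier_nonneg hα1 hy
  suffices h : ∀ ε > 0, V x ≤ m + (c + ε) * halfSpaceBarrier e x₀ α x by
    have hlim : Tendsto (fun ε ↦ m + (c + ε) * halfSpaceBarrier e x₀ α x) (𝓝[>] (0 : ℝ))
        (𝓝 (m + (c + 0) * halfSpaceBarrier e x₀ α x)) :=
      (Continuous.tendsto (by fun_prop) 0).mono_left nhdsWithin_le_nhds
    rw [add_zero] at hlim
    exact ge_of_tendsto hlim (eventually_mem_nhdsWithin.mono fun ε hε ↦ h ε hε)
  intro ε hε
  -- Outside a large ball the barrier dominates the bounded function.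
  obtain ⟨R, hRx, hR⟩ : ∃ R, ‖x - x₀‖ ≤ R ∧ M - m ≤ ε * R ^ α := by
    have := ((tendsto_rpow_atTop hα0).const_mul_atTop hε).eventually_ge_atTop (M - m)
    obtain ⟨R, h1, h2⟩ := ((eventually_ge_atTop ‖x - x₀‖).and this).exists
    exact ⟨R, h1, h2⟩
  have hclosed : IsClosed {y : E | 0 ≤ inner ℝ e y} :=
    isClosed_le continuous_const (by fun_prop)
  have hopen : IsOpen {y : E | 0 < inner ℝ e y} := isOpen_lt continuous_const (by fun_prop)
  have hBcont := continuous_halfSpaceBarrier e x₀ hα0.le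
  have hBdiff : ∀ y, 0 < inner ℝ e y →
      ContDiffAt ℝ 2 ((c + ε) • halfSpaceBarrier e x₀ α) y := fun y hy ↦
    contDiffAt_const.smul (contDiffAt_halfSpaceBarrier hx₀ hy α)
  have hVm : ∀ y, 0 < inner ℝ e y → HarmonicAt (V - fun _ ↦ m) y := fun y hy ↦
    (hV y hy).sub (harmonicAt_const m)
  have key := IsCompact.le_zero_of_laplacian_pos
    (K := Metric.closedBall x₀ R ∩ {y : E | 0 ≤ inner ℝ e y})
    (Ω := Metric.ball x₀ R ∩ {y : E | 0 < inner ℝ e y})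
    (f := (V - fun _ ↦ m) - (c + ε) • halfSpaceBarrier e x₀ α) (x := x)
    ((isCompact_closedBall x₀ R).inter_right hclosed) (Metric.isOpen_ball.inter hopen)
    (Set.inter_subset_inter Metric.ball_subset_closedBall
      (Set.ofPred_subset_ofPred.2 fun y hy ↦ le_of_lt hy))
    (((hcont.mono Set.inter_subset_right).sub continuousOn_const).sub
      (hBcont.const_smul (c + ε)).continuousOn)
    (fun y hy ↦ (hVm y hy.2).1.sub (hBdiff y hy.2))
    ?_ ?_ ⟨by simpa [dist_eq_norm] using hRx, hx⟩
  · simp only [Pi.sub_apply, Pi.smul_apply, smul_eq_mul] at key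
    linarith
  · intro y hy
    have hlt := laplacian_halfSpaceBarrier_neg he hx₀ hy.2 hα0 hα1
    rw [(hVm y hy.2).1.laplacian_sub (hBdiff y hy.2), (hVm y hy.2).2.self_of_nhds,
      laplacian_smul _ (contDiffAt_halfSpaceBarrier hx₀ hy.2 α)]
    simp only [Pi.zero_apply, smul_eq_mul]
    nlinarith
  · rintro y ⟨hyb, hy0⟩ hyΩ
    have hy0' : 0 ≤ inner ℝ e y := hy0
    have hle := norm_sub_rpow_le_halfSpaceBarrier (x₀ := x₀) hα1 hy0'
    simp only [Pi.sub_apply, Pi.smul_apply, smul_eq_mul]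
    rcases hy0'.eq_or_lt with hy | hy
    · have h1 := hbdry y hy.symm
      nlinarith [mul_le_mul_of_nonneg_left hle hc, mul_nonneg hε.le (hw y hy0')]
    · have hyR : ‖y - x₀‖ = R := by
        refine le_antisymm (by simpa [dist_eq_norm] using hyb) (not_lt.mp fun h ↦ hyΩ ⟨?_, hy⟩)
        simpa [dist_eq_norm] using h
      rw [hyR] at hle
      nlinarith [mul_le_mul_of_nonneg_left hle hε.le, mul_nonneg hc (hw y hy0'), hM y hy]

end

/-! ### Hölder estimates on the half-space -/

section

/-- Control of `|f|` along an interval controls `f`: if `f a` and `f b` have opposite signs, then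
`f` vanishes in between, which makes `|f a| ≤ B` and `|f b| ≤ 2 B`. -/
theorem abs_sub_le_of_abs_abs_sub_abs_le {f : ℝ → ℝ} {a b B : ℝ} (hab : a ≤ b)
    (hf : ContinuousOn f (Set.Icc a b))
    (hB : ∀ s ∈ Set.Icc a b, |(|f s| - |f a|)| ≤ B) : |f b - f a| ≤ 3 * B := by
  have hb := hB b ⟨hab, le_rfl⟩
  have hB0 : 0 ≤ B := (abs_nonneg _).trans hb
  have hzero : ∀ z ∈ Set.Icc a b, f z = 0 → |f b - f a| ≤ 3 * B := by
    intro z hz hfz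
    have h1 := hB z hz
    rw [hfz, abs_zero, zero_sub, abs_neg, abs_abs] at h1
    have h2 := (abs_le.mp hb).2
    have h3 := abs_sub (f b) (f a)
    linarith
  rcases le_total 0 (f a) with h0 | h0 <;> rcases le_total 0 (f b) with h1 | h1
  · rw [abs_of_nonneg h0, abs_of_nonneg h1] at hb; linarith
  · obtain ⟨z, hz, hfz⟩ := intermediate_value_Icc' hab hf ⟨h1, h0⟩
    exact hzero z hz hfz
  · obtain ⟨z, hz, hfz⟩ := intermediate_value_Icc hab hf ⟨h0, h1⟩
    exact hzero z hz hfz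
  · rw [abs_of_nonpos h0, abs_of_nonpos h1, abs_sub_comm] at hb
    rw [show f b - f a = -f a - -f b by ring, abs_sub_comm, abs_sub_comm (-f b)]
    linarith

variable {E : Type*} [NormedAddCommGroup E] [InnerProductSpace ℝ E]

theorem inner_add_smul_self {e : E} (he : ‖e‖ = 1) (x : E) (t : ℝ) :
    inner ℝ e (x + t • e) = inner ℝ e x + t := by
  rw [inner_add_right, inner_smul_right, real_inner_self_eq_norm_sq, he]; ring

theorem tendsto_add_smul_nhdsWithin {e : E} (he : ‖e‖ = 1) {x : E} (hx : 0 ≤ inner ℝ e x) :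
    Tendsto (fun s : ℝ ↦ x + s • e) (𝓝[>] 0) (𝓝[{x | 0 ≤ inner ℝ e x}] x) := by
  refine tendsto_nhdsWithin_iff.2 ⟨?_, eventually_mem_nhdsWithin.mono fun s hs ↦ ?_⟩
  · have : Continuous (fun s : ℝ ↦ x + s • e) := by fun_prop
    simpa using (this.tendsto 0).mono_left nhdsWithin_le_nhds
  · have : 0 < s := hs
    simp only [Set.mem_ofPred_eq, inner_add_smul_self he]; linarith

/-- A Hölder bound on the open half-space extends to the closed one, by shifting both points inward
by `s e` and letting `s → 0`. -/
theorem holder_closed_of_open {e : E} (he : ‖e‖ = 1) {U : E → ℝ}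
    (hU : ContinuousOn U {x | 0 ≤ inner ℝ e x}) {C α : ℝ}
    (h : ∀ x y, 0 < inner ℝ e x → 0 < inner ℝ e y → |U x - U y| ≤ C * ‖x - y‖ ^ α) {x y : E}
    (hx : 0 ≤ inner ℝ e x) (hy : 0 ≤ inner ℝ e y) : |U x - U y| ≤ C * ‖x - y‖ ^ α := by
  have hlim := (((hU x hx).tendsto.comp (tendsto_add_smul_nhdsWithin he hx)).sub
    ((hU y hy).tendsto.comp (tendsto_add_smul_nhdsWithin he hy))).abs
  refine le_of_tendsto hlim (eventually_mem_nhdsWithin.mono fun s hs ↦ ?_)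
  have hs' : 0 < s := hs
  have := h (x + s • e) (y + s • e) (by rw [inner_add_smul_self he]; linarith)
    (by rw [inner_add_smul_self he]; linarith)
  simpa using this

theorem vertical_of_abs_vertical {e : E} (he : ‖e‖ = 1) {U : E → ℝ}
    (hU : ContinuousOn U {x | 0 ≤ inner ℝ e x}) {C α : ℝ} (hC : 0 ≤ C) (hα : 0 ≤ α)
    (h : ∀ x t, inner ℝ e x = 0 → 0 < t → |(|U (x + t • e)| - |U x|)| ≤ C * t ^ α) {x : E}
    (hx : inner ℝ e x = 0) {t : ℝ} (ht : 0 < t) : |U (x + t • e) - U x| ≤ 3 * C * t ^ α := by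
  have := abs_sub_le_of_abs_abs_sub_abs_le (f := fun s ↦ U (x + s • e)) (a := 0) (b := t)
    (B := C * t ^ α) ht.le ?_ fun s hs ↦ ?_
  · simpa [mul_assoc] using this
  · refine hU.comp (by fun_prop) fun s hs ↦ ?_
    simpa [inner_add_smul_self he, hx] using hs.1
  · rcases hs.1.eq_or_lt with rfl | h0
    · simp only [sub_self, abs_zero]; positivity
    · have h1 := h x s hx h0
      have h2 := Real.rpow_le_rpow hs.1 hs.2 hα
      simp only [zero_smul, add_zero]
      exact h1.trans (by gcongr)

theorem boundary_of_abs_boundary {e : E} {U : E → ℝ}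
    (hU : ContinuousOn U {x | 0 ≤ inner ℝ e x}) {C α : ℝ} (hC : 0 ≤ C) (hα : 0 ≤ α)
    (h : ∀ x y, inner ℝ e x = 0 → inner ℝ e y = 0 → |(|U x| - |U y|)| ≤ C * ‖x - y‖ ^ α)
    {x y : E} (hx : inner ℝ e x = 0) (hy : inner ℝ e y = 0) :
    |U x - U y| ≤ 3 * C * ‖x - y‖ ^ α := by
  have hin : ∀ s : ℝ, inner ℝ e (y + s • (x - y)) = 0 := fun s ↦ by
    rw [inner_add_right, inner_smul_right, inner_sub_right, hx, hy]; ring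
  have := abs_sub_le_of_abs_abs_sub_abs_le (f := fun s : ℝ ↦ U (y + s • (x - y))) (a := 0) (b := 1)
    (B := C * ‖x - y‖ ^ α) zero_le_one ?_ fun s hs ↦ ?_
  · simpa [mul_assoc] using this
  · exact hU.comp (by fun_prop) fun s _ ↦ (hin s).ge
  · have h1 := h _ y (hin s) hy
    rw [add_sub_cancel_left, norm_smul, Real.norm_eq_abs, abs_of_nonneg hs.1] at h1
    have h2 : s * ‖x - y‖ ≤ ‖x - y‖ := mul_le_of_le_one_left (norm_nonneg _) hs.2
    have h3 := Real.rpow_le_rpow (mul_nonneg hs.1 (norm_nonneg _)) h2 hα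
    simp only [zero_smul, add_zero]
    exact h1.trans (by gcongr)

theorem exists_eq_add_smul {e : E} (he : ‖e‖ = 1) (x : E) :
    ∃ x₀, inner ℝ e x₀ = 0 ∧ x = x₀ + inner ℝ e x • e := by
  refine ⟨x - inner ℝ e x • e, ?_, by abel⟩
  rw [inner_sub_right, inner_smul_right, real_inner_self_eq_norm_sq, he]; ring

variable [FiniteDimensional ℝ E]

/-- `U` is harmonic on the open half-space `{0 < ⟪e, x⟫}`, continuous on the closed one, and bounded
by `M` in absolute value inside. Values outside the closed half-space are irrelevant. -/
structure IsBddHarmonicHalfSpace (e : E) (U : E → ℝ) (M : ℝ) : Prop where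
  harmonic : HarmonicOnNhd U {x | 0 < inner ℝ e x}
  continuousOn : ContinuousOn U {x | 0 ≤ inner ℝ e x}
  bounded : ∀ x, 0 < inner ℝ e x → |U x| ≤ M

namespace IsBddHarmonicHalfSpace

variable {e : E} {U : E → ℝ} {M : ℝ}

theorem neg (h : IsBddHarmonicHalfSpace e U M) : IsBddHarmonicHalfSpace e (-U) M :=
  ⟨h.harmonic.neg, h.continuousOn.neg, fun x hx ↦ by simpa using h.bounded x hx⟩

theorem sub_translate (h : IsBddHarmonicHalfSpace e U M) {a : E} (ha : 0 ≤ inner ℝ e a) :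
    IsBddHarmonicHalfSpace e (fun x ↦ U (x + a) - U x) (M + M) := by
  have h1 : ∀ x, 0 < inner ℝ e x → 0 < inner ℝ e (x + a) := fun x hx ↦ by
    rw [inner_add_right]; linarith
  refine ⟨fun x hx ↦ (h.harmonic (x + a) (h1 x hx)).comp_add_right.sub (h.harmonic x hx),
    (h.continuousOn.comp (by fun_prop) fun x hx ↦ ?_).sub h.continuousOn, fun x hx ↦ ?_⟩
  · have : 0 ≤ inner ℝ e x := hx
    simp only [Set.mem_ofPred_eq, inner_add_right]; linarith
  · exact (abs_sub _ _).trans (add_le_add (h.bounded _ (h1 x hx)) (h.bounded x hx))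

/-- Maximum principle for bounded harmonic functions: a bound on the boundary holds everywhere,
whatever the a priori bound `M`. -/
theorem abs_le_of_boundary (h : IsBddHarmonicHalfSpace e U M) (he : ‖e‖ = 1) {m : ℝ}
    (hm : ∀ x, inner ℝ e x = 0 → |U x| ≤ m) {x : E} (hx : 0 ≤ inner ℝ e x) : |U x| ≤ m := by
  -- With `c = 0` the exponent of the barrier plays no role in the statement; `1 / 2` is a choice.
  have key : ∀ {V : E → ℝ}, IsBddHarmonicHalfSpace e V M →
      (∀ x, inner ℝ e x = 0 → |V x| ≤ m) → V x ≤ m := fun {V} hV hVm ↦ by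
    simpa using hV.harmonic.le_add_mul_halfSpaceBarrier he (inner_zero_right e)
      (one_half_pos (α := ℝ)) one_half_lt_one (M := M) (m := m) le_rfl hV.continuousOn
      (fun y hy ↦ (le_abs_self _).trans (hV.bounded y hy))
      (fun y hy ↦ by simpa using (le_abs_self _).trans (hVm y hy)) hx
  have h2 := key h.neg fun y hy ↦ by simpa using hm y hy
  exact abs_le.mpr ⟨by simp only [Pi.neg_apply] at h2; linarith, key h hm⟩

/-- Hölder boundary values give Hölder control along the normals, by comparison with the barrier. -/
theorem vertical_of_boundary (h : IsBddHarmonicHalfSpace e U M) (he : ‖e‖ = 1) {α : ℝ}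
    (hα0 : 0 < α) (hα1 : α < 1) {C : ℝ} (hC : 0 ≤ C)
    (hU : ∀ x y, inner ℝ e x = 0 → inner ℝ e y = 0 → |U x - U y| ≤ C * ‖x - y‖ ^ α) :
    ∃ C', 0 ≤ C' ∧ ∀ x t, inner ℝ e x = 0 → 0 ≤ t → |U (x + t • e) - U x| ≤ C' * t ^ α := by
  set k : ℝ := (finrank ℝ E + 1) / (1 - α) with hk
  have hk0 : 0 ≤ k := div_nonneg (by positivity) (by linarith)
  refine ⟨C * (1 + k), by positivity, fun x t hx ht ↦ ?_⟩
  have hxt : inner ℝ e (x + t • e) = t := by rw [inner_add_smul_self he, hx, zero_add]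
  have hbar : halfSpaceBarrier e x α (x + t • e) = (1 + k) * t ^ α := by
    rw [halfSpaceBarrier, hxt, add_sub_cancel_left, norm_smul, he, Real.norm_eq_abs,
      abs_of_nonneg ht, mul_one, ← hk]
    ring
  have key : ∀ {V : E → ℝ}, IsBddHarmonicHalfSpace e V M →
      (∀ y, inner ℝ e y = 0 → |V y - V x| ≤ C * ‖y - x‖ ^ α) →
      V (x + t • e) ≤ V x + C * (1 + k) * t ^ α := fun {V} hV hVC ↦ by
    have := hV.harmonic.le_add_mul_halfSpaceBarrier he hx hα0 hα1 (M := M) (m := V x) hC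
      hV.continuousOn (fun y hy ↦ (le_abs_self _).trans (hV.bounded y hy))
      (fun y hy ↦ by linarith [(abs_le.mp (hVC y hy)).2]) (hxt.symm ▸ ht)
    rwa [hbar, ← mul_assoc] at this
  have h1 := key h fun y hy ↦ hU y x hy hx
  have h2 := key h.neg fun y hy ↦ by
    simpa [abs_sub_comm, neg_add_eq_sub] using hU y x hy hx
  simp only [Pi.neg_apply] at h2
  exact abs_le.mpr ⟨by linarith, by linarith⟩

/-- Hölder boundary values give a function Hölder on the closed half-space: for an inward shift `a`,
the maximum principle applies to `x ↦ U (x + a) - U x`. -/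
theorem holder_of_boundary (h : IsBddHarmonicHalfSpace e U M) (he : ‖e‖ = 1) {α : ℝ}
    (hα0 : 0 < α) (hα1 : α < 1) {C : ℝ} (hC : 0 ≤ C)
    (hU : ∀ x y, inner ℝ e x = 0 → inner ℝ e y = 0 → |U x - U y| ≤ C * ‖x - y‖ ^ α) :
    ∃ C', ∀ x y, 0 ≤ inner ℝ e x → 0 ≤ inner ℝ e y → |U x - U y| ≤ C' * ‖x - y‖ ^ α := by
  obtain ⟨C₁, hC₁, hvert⟩ := h.vertical_of_boundary he hα0 hα1 hC hU
  have key : ∀ x y, 0 ≤ inner ℝ e x → inner ℝ e x ≤ inner ℝ e y →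
      |U y - U x| ≤ (C₁ + C) * ‖y - x‖ ^ α := by
    intro x y hx hxy
    have ha : 0 ≤ inner ℝ e (y - x) := by rw [inner_sub_right]; linarith
    have := (h.sub_translate ha).abs_le_of_boundary he (m := (C₁ + C) * ‖y - x‖ ^ α) ?_ hx
    · simpa using this
    intro z hz
    -- From a boundary point `z`, first shift by the tangential part `a`, then by the normal part.
    obtain ⟨a, ha0, hae⟩ := exists_eq_add_smul he (y - x)
    set s := inner ℝ e (y - x) with hs
    have hza : inner ℝ e (z + a) = 0 := by rw [inner_add_right, hz, ha0, add_zero]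
    have hsle : s ≤ ‖y - x‖ := by simpa [he] using real_inner_le_norm e (y - x)
    have hale : ‖a‖ ≤ ‖y - x‖ := by
      have : ‖y - x‖ ^ 2 = ‖a‖ ^ 2 + s ^ 2 := by
        conv_lhs => rw [hae]
        rw [norm_add_smul_sq_real a e he, real_inner_comm, ha0]; ring
      exact (sq_le_sq₀ (norm_nonneg _) (norm_nonneg _)).1
        (by rw [this]; exact le_add_of_nonneg_right (sq_nonneg s))
    have h1 := hvert (z + a) s hza ha
    have h2 := hU (z + a) z hza hz
    rw [add_sub_cancel_left] at h2
    have h3 : z + (y - x) = z + a + s • e := by rw [add_assoc, ← hae]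
    have h4 : s ^ α ≤ ‖y - x‖ ^ α := Real.rpow_le_rpow ha hsle hα0.le
    have h5 : ‖a‖ ^ α ≤ ‖y - x‖ ^ α := Real.rpow_le_rpow (norm_nonneg a) hale hα0.le
    rw [h3]
    calc _ ≤ |U (z + a + s • e) - U (z + a)| + |U (z + a) - U z| := abs_sub_le _ _ _
      _ ≤ C₁ * s ^ α + C * ‖a‖ ^ α := add_le_add h1 h2
      _ ≤ C₁ * ‖y - x‖ ^ α + C * ‖y - x‖ ^ α := by gcongr
      _ = _ := by ring
  refine ⟨C₁ + C, fun x y hx hy ↦ ?_⟩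
  rcases le_total (inner ℝ e x) (inner ℝ e y) with hxy | hxy
  · rw [abs_sub_comm, norm_sub_rev]; exact key x y hx hxy
  · exact key y x hy hxy

/-- Tangential Lipschitz estimate at height `t`, from the interior estimate on the ball of radius
`t / 2` about the midpoint of `x` and `x + k`. -/
theorem abs_sub_le_of_tangential (h : IsBddHarmonicHalfSpace e U M) (he : ‖e‖ = 1) (hM : 0 < M)
    {x k : E} (hk : inner ℝ e k = 0) {t : ℝ} (ht : 0 < t) (hx : inner ℝ e x = t) (hkt : ‖k‖ ≤ t) :
    |U (x + k) - U x| ≤ 2 * M * (finrank ℝ E + 1) * (‖k‖ / t) := by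
  have hsub : ∀ z ∈ Metric.closedBall (midpoint ℝ (x + k) x) (t / 2), 0 < inner ℝ e z := by
    intro z hz
    have hmid : inner ℝ e (midpoint ℝ (x + k) x) = t := by
      rw [midpoint_eq_smul_add, inner_smul_right, inner_add_right, inner_add_right, hk, hx,
        invOf_eq_inv]
      ring
    have h1 := abs_real_inner_le_norm e (z - midpoint ℝ (x + k) x)
    rw [he, one_mul, inner_sub_right, hmid, ← dist_eq_norm] at h1
    have h2 := (abs_le.mp (h1.trans (Metric.mem_closedBall.mp hz))).1
    linarith
  have := HarmonicOnNhd.abs_sub_le_of_bounded_closedBall (V := U) (half_pos ht) hM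
    (h.harmonic.mono hsub) (fun z hz ↦ h.bounded z (hsub z hz))
    (by simpa [mul_div_cancel₀] using hkt)
  refine this.trans_eq ?_
  rw [add_sub_cancel_left]
  field_simp

/-- Hölder control along the normals gives Hölder boundary values. The tangential difference `D j`
of `U` at height `2 ^ j ‖x - y‖` tends to `0`, with increments bounded by a geometric series. -/
theorem boundary_of_vertical (h : IsBddHarmonicHalfSpace e U M) (he : ‖e‖ = 1) (hM : 0 < M)
    {α : ℝ} (hα1 : α < 1) {C : ℝ} (hC : 0 < C)
    (hU : ∀ x t, inner ℝ e x = 0 → 0 < t → |U (x + t • e) - U x| ≤ C * t ^ α) :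
    ∃ C', 0 ≤ C' ∧ ∀ x y, inner ℝ e x = 0 → inner ℝ e y = 0 →
      |U x - U y| ≤ C' * ‖x - y‖ ^ α := by
  set n : ℝ := finrank ℝ E + 1 with hn
  have hn0 : 0 < n := by positivity
  set q : ℝ := 2 ^ (α - 1) with hq
  have hq0 : 0 < q := by positivity
  have hq1 : q < 1 := Real.rpow_lt_one_of_one_lt_of_neg one_lt_two (by linarith)
  have hq1' : 0 < 1 - q := by linarith
  set A : ℝ := 2 * C * n / (1 - q) with hA
  have hA0 : 0 ≤ A := by positivity
  refine ⟨2 * C + A, by positivity, fun x y hx hy ↦ ?_⟩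
  rcases eq_or_ne x y with rfl | hne
  · simp only [sub_self, abs_zero, norm_zero]; positivity
  set k := x - y with hkdef
  have hk : inner ℝ e k = 0 := by rw [hkdef, inner_sub_right, hx, hy, sub_zero]
  set τ := ‖k‖ with hτ
  have hτ0 : 0 < τ := norm_sub_pos_iff.mpr hne
  set D : ℕ → ℝ := fun j ↦ U (y + (2 ^ j * τ) • e + k) - U (y + (2 ^ j * τ) • e) with hD
  have hinn : ∀ t : ℝ, inner ℝ e (y + t • e) = t := fun t ↦ by
    rw [inner_add_smul_self he, hy, zero_add]
  have hpow1 : ∀ j : ℕ, τ ≤ 2 ^ j * τ := fun j ↦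
    le_mul_of_one_le_left hτ0.le (one_le_pow₀ one_le_two)
  have hstep : ∀ j, dist (D j) (D (j + 1)) ≤ 2 * C * n * τ ^ α * q ^ j := by
    intro j
    set t : ℝ := 2 ^ j * τ with ht
    have ht0 : 0 < t := by positivity
    have hte : inner ℝ e (t • e) = t := by simpa using inner_add_smul_self he 0 t
    -- `D (j + 1) - D j` is the tangential difference at height `t` of `x ↦ U (x + t e) - U x`,
    -- which is bounded by `C * t ^ α`.
    have hW0 := h.sub_translate (a := t • e) (by rw [hte]; exact ht0.le)
    have hW : IsBddHarmonicHalfSpace e (fun x ↦ U (x + t • e) - U x) (C * t ^ α) :=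
      ⟨hW0.harmonic, hW0.continuousOn, fun z hz ↦
        hW0.abs_le_of_boundary he (fun w hw ↦ hU w t hw ht0) (le_of_lt hz)⟩
    have h1 := hW.abs_sub_le_of_tangential he (by positivity) hk ht0 (hinn t) (hpow1 j)
    have h2 : (2 : ℝ) ^ (j + 1) * τ = t + t := by rw [ht]; ring
    have h3 : dist (D j) (D (j + 1)) = |U (y + t • e + k + t • e) - U (y + t • e + k)
        - (U (y + t • e + t • e) - U (y + t • e))| := by
      rw [dist_comm, Real.dist_eq]
      simp only [hD, h2, ← ht]
      rw [add_smul, ← add_assoc, add_right_comm (y + t • e) (t • e) k]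
      congr 1; ring
    rw [h3]
    refine h1.trans_eq ?_
    have h4 : t ^ α * (τ / t) = τ ^ α * q ^ j := by
      rw [hq, ← Real.rpow_natCast, ← Real.rpow_mul zero_le_two, mul_comm (α - 1),
        Real.rpow_mul zero_le_two, Real.rpow_natCast, Real.rpow_sub_one (by positivity), ht,
        Real.mul_rpow (by positivity) hτ0.le]
      field_simp
    calc _ = 2 * C * n * (t ^ α * (τ / t)) := by ring
      _ = _ := by rw [h4]; ring
  have hlim : Tendsto D atTop (𝓝 0) := by
    have hb : ∀ j, ‖D j‖ ≤ 2 * M * n * (1 / 2) ^ j := fun j ↦ by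
      have := h.abs_sub_le_of_tangential he hM hk (by positivity) (hinn (2 ^ j * τ)) (hpow1 j)
      refine (Real.norm_eq_abs _).trans_le (this.trans_eq ?_)
      rw [← hτ, ← hn, div_pow, one_pow]; field_simp
    refine squeeze_zero_norm hb ?_
    simpa using (tendsto_pow_atTop_nhds_zero_of_lt_one (r := (1 / 2 : ℝ)) (by norm_num)
      (by norm_num)).const_mul (2 * M * n)
  have hD0 : |U (x + τ • e) - U (y + τ • e)| ≤ A * τ ^ α := by
    have := dist_le_of_le_geometric_of_tendsto₀ q (2 * C * n * τ ^ α) hq1 hstep hlim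
    simp only [hD, pow_zero, one_mul, Real.dist_eq, sub_zero] at this
    rw [show y + τ • e + k = x + τ • e by rw [hkdef]; abel] at this
    refine this.trans_eq ?_
    rw [hA]; ring
  have h1 := hU x τ hx hτ0
  have h2 := hU y τ hy hτ0
  rw [abs_sub_comm] at h1
  calc |U x - U y| ≤ |U x - U (x + τ • e)| + |U (x + τ • e) - U y| := abs_sub_le _ _ _
    _ ≤ |U x - U (x + τ • e)| + (|U (x + τ • e) - U (y + τ • e)| + |U (y + τ • e) - U y|) := by
      gcongr; exact abs_sub_le _ _ _
    _ ≤ (2 * C + A) * τ ^ α := by linarith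

end IsBddHarmonicHalfSpace

end

/-! ### The half-space in coordinates -/

section

variable {d : ℕ}

theorem inner_single_last (x : EuclideanSpace ℝ (Fin (d + 1))) :
    inner ℝ (EuclideanSpace.single (Fin.last d) (1 : ℝ)) x = x (Fin.last d) := by
  simp [EuclideanSpace.inner_single_left]

theorem halfSpacePoint_last (x' : EuclideanSpace ℝ (Fin d)) (t : ℝ) :
    halfSpacePoint x' t (Fin.last d) = t := by
  simp [halfSpacePoint]

theorem halfSpacePoint_eq_add_smul (x' : EuclideanSpace ℝ (Fin d)) (t : ℝ) :
    halfSpacePoint x' t = halfSpacePoint x' 0 + t • EuclideanSpace.single (Fin.last d) (1 : ℝ) := by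
  ext i
  refine Fin.lastCases ?_ (fun i ↦ ?_) i <;> simp [halfSpacePoint]

theorem norm_halfSpacePoint_sub (x' y' : EuclideanSpace ℝ (Fin d)) :
    ‖halfSpacePoint x' 0 - halfSpacePoint y' 0‖ = ‖x' - y'‖ := by
  simp [EuclideanSpace.norm_eq, Fin.sum_univ_castSucc, halfSpacePoint]

theorem exists_eq_halfSpacePoint {x : EuclideanSpace ℝ (Fin (d + 1))} (hx : x (Fin.last d) = 0) :
    ∃ x', x = halfSpacePoint x' 0 := by
  refine ⟨WithLp.toLp 2 fun i ↦ x i.castSucc, ?_⟩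
  ext i
  refine Fin.lastCases ?_ (fun i ↦ ?_) i <;> simp [halfSpacePoint, hx]

theorem closure_upperHalfSpace :
    closure (upperHalfSpace d) = {x | 0 ≤ x (Fin.last d)} := by
  refine subset_antisymm (closure_minimal (Set.ofPred_subset_ofPred.2 fun x hx ↦ le_of_lt hx)
    (isClosed_le continuous_const (by fun_prop))) fun x hx ↦ ?_
  have hx' : 0 ≤ x (Fin.last d) := hx
  rw [← inner_single_last] at hx'
  refine mem_closure_of_tendsto ((tendsto_add_smul_nhdsWithin (by simp) hx').mono_right
    nhdsWithin_le_nhds) (eventually_mem_nhdsWithin.mono fun s hs ↦ ?_)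
  have : 0 < s := hs
  rw [inner_single_last] at hx'
  simp only [upperHalfSpace, Set.mem_ofPred_eq, PiLp.add_apply, PiLp.smul_apply,
    PiLp.single_apply, if_true, smul_eq_mul, mul_one]
  linarith

end

theorem mainTheorem1 (d : ℕ) (α : ℝ) (hα0 : 0 < α) (hα1 : α < 1)
    (U : EuclideanSpace ℝ (Fin (d + 1)) → ℝ)
    (hharm : InnerProductSpace.HarmonicOnNhd U (upperHalfSpace d))
    (hcont : ContinuousOn U (closure (upperHalfSpace d)))
    (hbdd : ∃ M : ℝ, ∀ x ∈ upperHalfSpace d, |U x| ≤ M) :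
    List.TFAE [
      ∃ C : ℝ, ∀ x ∈ upperHalfSpace d, ∀ y ∈ upperHalfSpace d,
        |U x - U y| ≤ C * ‖x - y‖ ^ α,
      ∃ C : ℝ, ∀ x' y' : EuclideanSpace ℝ (Fin d),
        |(|U (halfSpacePoint x' 0)| - |U (halfSpacePoint y' 0)|)| ≤ C * ‖x' - y'‖ ^ α,
      ∃ C : ℝ, ∀ (x' : EuclideanSpace ℝ (Fin d)) (t : ℝ), 0 < t →
        |(|U (halfSpacePoint x' t)| - |U (halfSpacePoint x' 0)|)| ≤ C * t ^ α] := by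
  set e : EuclideanSpace ℝ (Fin (d + 1)) := EuclideanSpace.single (Fin.last d) 1 with he_def
  have he : ‖e‖ = 1 := by simp [he_def]
  have hin : ∀ x, inner ℝ e x = x (Fin.last d) := inner_single_last
  have hin0 : ∀ x', inner ℝ e (halfSpacePoint x' 0) = 0 := fun x' ↦ by
    rw [hin, halfSpacePoint_last]
  have hopen : upperHalfSpace d = {x | 0 < inner ℝ e x} := by
    simp only [hin]; rfl
  have hclosed : closure (upperHalfSpace d) = {x | 0 ≤ inner ℝ e x} := by
    simp only [hin, closure_upperHalfSpace]
  obtain ⟨M, hM⟩ := hbdd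
  -- The constants in the hypotheses may be negative (no tangential direction if `d = 0`), or zero,
  -- while the estimates want nonnegative or positive ones; hence the maxima with `0` and `1`.
  have h : IsBddHarmonicHalfSpace e U (max M 1) :=
    ⟨hopen ▸ hharm, hclosed ▸ hcont, fun x hx ↦
      (hM x (by rw [hopen]; exact hx)).trans (le_max_left _ _)⟩
  have hM0 : 0 < max M 1 := lt_max_of_lt_right one_pos
  have hclosedHolder : ∀ {C : ℝ}, (∀ x ∈ upperHalfSpace d, ∀ y ∈ upperHalfSpace d,
      |U x - U y| ≤ C * ‖x - y‖ ^ α) → ∀ x y, 0 ≤ inner ℝ e x → 0 ≤ inner ℝ e y →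
      |U x - U y| ≤ C * ‖x - y‖ ^ α := fun {C} hC x y hx hy ↦
    holder_closed_of_open he h.continuousOn (fun x y hx hy ↦ hC x (by rwa [hopen]) y
      (by rwa [hopen])) hx hy
  have hbdryHolder : ∀ {C : ℝ}, 0 ≤ C → (∀ x y, inner ℝ e x = 0 → inner ℝ e y = 0 →
      |U x - U y| ≤ C * ‖x - y‖ ^ α) → ∃ C : ℝ, ∀ x ∈ upperHalfSpace d, ∀ y ∈ upperHalfSpace d,
        |U x - U y| ≤ C * ‖x - y‖ ^ α := fun hC hbd ↦ by
    obtain ⟨C', hC'⟩ := h.holder_of_boundary he hα0 hα1 hC hbd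
    rw [hopen]
    exact ⟨C', fun x hx y hy ↦ hC' x y (le_of_lt hx) (le_of_lt hy)⟩
  tfae_have 1 → 2 := fun ⟨C, hC⟩ ↦ ⟨C, fun x' y' ↦ by
    rw [← norm_halfSpacePoint_sub]
    exact (abs_abs_sub_abs_le_abs_sub _ _).trans
      (hclosedHolder hC _ _ (hin0 x').ge (hin0 y').ge)⟩
  tfae_have 1 → 3 := fun ⟨C, hC⟩ ↦ ⟨C, fun x' t ht ↦ by
    refine (abs_abs_sub_abs_le_abs_sub _ _).trans
      ((hclosedHolder hC _ _ ?_ (hin0 x').ge).trans_eq ?_)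
    · rw [hin, halfSpacePoint_last]; exact ht.le
    · rw [halfSpacePoint_eq_add_smul, add_sub_cancel_left, norm_smul, ← he_def, he, mul_one,
        Real.norm_eq_abs, abs_of_pos ht]⟩
  tfae_have 2 → 1 := fun ⟨C, hC⟩ ↦ by
    have hbd : ∀ x y, inner ℝ e x = 0 → inner ℝ e y = 0 →
        |(|U x| - |U y|)| ≤ max C 0 * ‖x - y‖ ^ α := fun x y hx hy ↦ by
      obtain ⟨x', rfl⟩ := exists_eq_halfSpacePoint ((hin x).symm.trans hx)
      obtain ⟨y', rfl⟩ := exists_eq_halfSpacePoint ((hin y).symm.trans hy)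
      rw [norm_halfSpacePoint_sub]
      refine (hC x' y').trans ?_
      gcongr
      exact le_max_left _ _
    exact hbdryHolder (C := 3 * max C 0) (by positivity) fun x y hx hy ↦
      boundary_of_abs_boundary h.continuousOn (le_max_right _ _) hα0.le hbd hx hy
  tfae_have 3 → 1 := fun ⟨C, hC⟩ ↦ by
    have hv : ∀ x t, inner ℝ e x = 0 → 0 < t →
        |(|U (x + t • e)| - |U x|)| ≤ max C 1 * t ^ α := fun x t hx ht ↦ by
      obtain ⟨x', rfl⟩ := exists_eq_halfSpacePoint ((hin x).symm.trans hx)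
      rw [← halfSpacePoint_eq_add_smul]
      refine (hC x' t ht).trans ?_
      gcongr
      exact le_max_left _ _
    have hC1 : 0 < max C 1 := lt_max_of_lt_right one_pos
    obtain ⟨C', hC'0, hC'⟩ := h.boundary_of_vertical he hM0 hα1 (C := 3 * max C 1) (by positivity)
      fun x t hx ht ↦ vertical_of_abs_vertical he h.continuousOn hC1.le hα0.le hv hx ht
    exact hbdryHolder hC'0 hC'
  tfae_finish
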